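/- Let $G=(0,\pi)$, $T>0$, $(g,h)_0=\int_0^\pi g(x)h(x)\,dx$, $\|h\|_0^2=(h,h)_0$, and $\|h\|_1^2=\|h\|_0^2+\|h'\|_0^2$; let $H^1_0(G)$ be the closure of the smooth functions with compact support in $G$ with respect to $\|\cdot\|_1$. For $W\in L_\infty(G)$ and $\varphi\in L_2(G)$, a generalized solution of $$v_t=(v_x+vW)_x-v_xW,\qquad v|_{t=0}=\varphi,\qquad v|_{x=0}=v|_{x=\pi}=0,$$ is an element $v$ of $L_2((0,T);H^1_0(G))$ (with a version $t\mapsto v(t)\in L_2(G)$ defined for every $t\in(0,T)$) such that, for every $h\in H^1_0(G)$ and every $t\in(0,T)$, $$(v,h)_0(t)=(\varphi,h)_0-\int_0^t (v_x+vW,h')_0(s)\,ds-\int_0^t (v_xW,h)_0(s)\,ds .$$ When the coefficient is $W$, this is called the generalized geometric rough path (GRP) solution of $u_t=u_{xx}+u\dot W$ with initial condition $\varphi$ and zero boundary conditions. **Theorem 3.2.** Let $W\in L_\infty(G)$, let $W^{(\varepsilon)}\in L_\infty(G)$ for all $\varepsilon>0$, and let $\varphi\in L_2(G)$. Let $u$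 be the generalized solution with coefficient $W$ and, for every $\varepsilon>0$, let $u^{(\varepsilon)}$ be the generalized solution with coefficient $W^{(\varepsilon)}$, all with the initial condition $\varphi$. If $$\lim_{\varepsilon\to0}\|W-W^{(\varepsilon)}\|_{L_\infty(G)}=0,$$ then $$\lim_{\varepsilon\to0}\Big(\sup_{t\in(0,T)}\|u-u^{(\varepsilon)}\|_0^2(t)+\int_0^T\|u-u^{(\varepsilon)}\|_1^2(s)\,ds\Big)=0 .$$ -/

import Mathlib

open MeasureTheory Set Filter Topology
open scoped ENNReal ContDiff

noncomputable section

namespace GRP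

/-- The spatial interval `G = (0, π)`. -/
abbrev G : Set ℝ := Ioo 0 Real.pi

/-- The real Hilbert space `L₂(G)`; its inner product is `(·,·)₀`, its norm is `‖·‖₀`. -/
abbrev L2G : Type := Lp ℝ 2 (volume.restrict G)

/-- The real Banach space `L_∞(G)`. -/
abbrev LInfG : Type := Lp ℝ ∞ (volume.restrict G)

/-- Smooth functions on `ℝ` with compact support contained in `G`. -/
def IsTestFunction (f : ℝ → ℝ) : Prop :=
  ContDiff ℝ ∞ f ∧ HasCompactSupport f ∧ tsupport f ⊆ G

/-- All pairs `(f, f')`, `f` smooth with compact support in `G`, as a subspace of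
`L₂(G) × L₂(G)` with the Hilbert norm `‖(g, k)‖² = ‖g‖₀² + ‖k‖₀²`. -/
def testGraph : Submodule ℝ (WithLp 2 (L2G × L2G)) where
  carrier := {p | ∃ f : ℝ → ℝ, IsTestFunction f ∧
    p.fst =ᵐ[volume.restrict G] f ∧ p.snd =ᵐ[volume.restrict G] deriv f}
  zero_mem' := by
    refine ⟨0, ⟨contDiff_const, HasCompactSupport.zero, by simp [tsupport]⟩, ?_, ?_⟩
    · exact Lp.coeFn_zero ℝ 2 _
    · have h : deriv (0 : ℝ → ℝ) = 0 := by ext x; simp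
      rw [h]; exact Lp.coeFn_zero ℝ 2 _
  add_mem' := by
    rintro p q ⟨f, ⟨hf, hfc, hfs⟩, hp, hp'⟩ ⟨g, ⟨hg, hgc, hgs⟩, hq, hq'⟩
    refine ⟨f + g, ⟨hf.add hg, hfc.add hgc, ?_⟩, ?_, ?_⟩
    · exact (tsupport_add f g).trans (union_subset hfs hgs)
    · exact (Lp.coeFn_add p.fst q.fst).trans (hp.add hq)
    · have h : deriv (f + g) = deriv f + deriv g := by
        ext x
        exact deriv_add (hf.differentiable (by simp) x) (hg.differentiable (by simp) x)
      rw [h]; exact (Lp.coeFn_add p.snd q.snd).trans (hp'.add hq')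
  smul_mem' := by
    rintro c p ⟨f, ⟨hf, hfc, hfs⟩, hp, hp'⟩
    refine ⟨c • f, ⟨contDiff_const.smul hf, hfc.smul_left (f := fun _ => c), ?_⟩, ?_, ?_⟩
    · exact (tsupport_smul_subset_right (fun _ => c) f).trans hfs
    · exact (Lp.coeFn_smul c p.fst).trans (hp.const_smul c)
    · have h : deriv (c • f) = c • deriv f := by
        ext x
        exact deriv_const_smul c (hf.differentiable (by simp) x)
      rw [h]; exact (Lp.coeFn_smul c p.snd).trans (hp'.const_smul c)

/-- The Sobolev space `H¹₀(G)`: the closure of the smooth functions with compact support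
in `G` with respect to `‖h‖₁² = ‖h‖₀² + ‖h'‖₀²`. An element is recorded as the pair
`(h, h')` of a function and its generalized derivative (see `H10.integral_derivative`), so
the norm inherited from `L₂(G) × L₂(G)` is `‖·‖₁` (see `H10.norm_sq`). -/
abbrev H10 : Type := testGraph.topologicalClosure

/-- The function `h ∈ L₂(G)` underlying an element of `H¹₀(G)`. -/
def H10.toL2 (h : H10) : L2G := h.1.fst

/-- The generalized derivative `h' ∈ L₂(G)` of an element of `H¹₀(G)`. -/
def H10.derivative (h : H10) : L2G := h.1.snd

theorem H10.norm_sq (h : H10) : ‖h‖ ^ 2 = ‖h.toL2‖ ^ 2 + ‖h.derivative‖ ^ 2 :=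
  WithLp.prod_norm_sq_eq_of_L2 h.1

/-- `h.derivative` is the generalized derivative of `h.toL2`. -/
theorem H10.integral_derivative (h : H10) (f : ℝ → ℝ) (hf : IsTestFunction f) :
    ∫ x in G, h.derivative x * f x = - ∫ x in G, h.toL2 x * deriv f x := by
  obtain ⟨hfs, hfc, hfG⟩ := hf
  have hfd : Continuous (deriv f) := hfs.continuous_deriv (by simp)
  have hm : MemLp f 2 (volume.restrict G) :=
    (hfs.continuous.memLp_of_hasCompactSupport hfc).restrict G
  have hm' : MemLp (deriv f) 2 (volume.restrict G) :=
    (hfd.memLp_of_hasCompactSupport hfc.deriv).restrict G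
  have key : ∀ (g : L2G) (k : ℝ → ℝ) (hk : MemLp k 2 (volume.restrict G)),
      ∫ x in G, g x * k x = inner ℝ (hk.toLp k) g := by
    intro g k hk
    rw [L2.inner_def]
    refine integral_congr_ae ?_
    filter_upwards [hk.coeFn_toLp] with x hx
    simp [hx]
  obtain ⟨p, hp⟩ := h
  change ∫ x in G, p.snd x * f x = - ∫ x in G, p.fst x * deriv f x
  rw [key _ f hm, key _ _ hm']
  have hcl : IsClosed {p : WithLp 2 (L2G × L2G) |
      inner ℝ (hm.toLp f) p.snd = - inner ℝ (hm'.toLp (deriv f)) p.fst} :=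
    isClosed_eq (continuous_const.inner (WithLp.continuous_snd 2 L2G L2G))
      (continuous_const.inner (WithLp.continuous_fst 2 L2G L2G)).neg
  refine closure_minimal ?_ hcl hp
  rintro q ⟨g, ⟨hgs, hgc, hgG⟩, hq, hq'⟩
  change inner ℝ (hm.toLp f) q.snd = - inner ℝ (hm'.toLp (deriv f)) q.fst
  rw [← key, ← key]
  have hgd : Continuous (deriv g) := hgs.continuous_deriv (by simp)
  have e1 : ∫ x in G, q.snd x * f x = ∫ x, deriv g x * f x := by
    have h : ∫ x in G, deriv g x * f x = ∫ x, deriv g x * f x := by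
      refine setIntegral_eq_integral_of_forall_compl_eq_zero fun x hx => ?_
      rw [image_eq_zero_of_notMem_tsupport (fun h => hx (hfG h)), mul_zero]
    rw [← h]
    refine integral_congr_ae ?_
    filter_upwards [hq'] with x hx
    rw [hx]
  have e2 : ∫ x in G, q.fst x * deriv f x = ∫ x, g x * deriv f x := by
    have h : ∫ x in G, g x * deriv f x = ∫ x, g x * deriv f x := by
      refine setIntegral_eq_integral_of_forall_compl_eq_zero fun x hx => ?_
      rw [image_eq_zero_of_notMem_tsupport (fun h => hx (hgG h)), zero_mul]
    rw [← h]
    refine integral_congr_ae ?_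
    filter_upwards [hq] with x hx
    rw [hx]
  rw [e1, e2, integral_mul_deriv_eq_deriv_mul_of_integrable
    (fun x _ => (hgs.differentiable (by simp) x).hasDerivAt)
    (fun x _ => (hfs.differentiable (by simp) x).hasDerivAt), neg_neg]
  · exact (hgs.continuous.mul hfd).integrable_of_hasCompactSupport hgc.mul_right
  · exact (hgd.mul hfs.continuous).integrable_of_hasCompactSupport hgc.deriv.mul_right
  · exact (hgs.continuous.mul hfs.continuous).integrable_of_hasCompactSupport hgc.mul_right

/-- `L₂((0,T); H¹₀(G))`. -/
abbrev L2H10 (T : ℝ) : Type := Lp H10 2 (volume.restrict (Ioo 0 T))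

/-- The generalized solution of `v_t = (v_x + v W)_x - v_x W` on `(0,T) × G` with zero
Dirichlet boundary conditions and initial condition `φ ∈ L₂(G)`.

The solution is an element `v` of `L₂((0,T); H¹₀(G))`. Such an element is only defined for
almost every `t`, whereas the variational identity is required for every `t ∈ (0,T)`; so
`vt` denotes the `L₂(G)`-valued version of `v` whose value at `t` enters the left-hand
side `(v,h)₀(t)` (the identity determines `vt t` for every `t ∈ (0,T)`). -/
structure IsGeneralizedSolution (T : ℝ) (W : LInfG) (φ : L2G)
    (v : L2H10 T) (vt : ℝ → L2G) : Prop where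
  version : ∀ᵐ t ∂(volume.restrict (Ioo 0 T)), vt t = (v t).toL2
  identity : ∀ h : H10, ∀ t ∈ Ioo 0 T,
    ∫ x in G, vt t x * h.toL2 x =
      (∫ x in G, φ x * h.toL2 x)
        - (∫ s in (0 : ℝ)..t, ∫ x in G,
            ((v s).derivative x + (v s).toL2 x * W x) * h.derivative x)
        - ∫ s in (0 : ℝ)..t, ∫ x in G, (v s).derivative x * W x * h.toL2 x

end GRP

end

/-! The difference `w` of two solutions satisfies an energy identity whose right side is coercive up
to lower-order terms. The change of coefficient enters only as `‖W - W'‖ ^ 2 * ‖u‖ ^ 2`, with `u`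
the fixed solution. Gronwall's inequality then bounds the sup and the integral by a constant times
`‖W - W'‖ ^ 2`, uniformly over bounded `W'` (`neg_two_inner_formOperator_sub_le`,
`primitive_add_integral_le_of_gronwall`).

The delicate point is the energy identity, as `w` has a time derivative only in the dual of `H10`.
With `j : H10 → L2G` the embedding, the weak equation says that `j† w` is minus the primitive of an
integrable `H10`-valued function `F`. Formally `‖w‖ ^ 2` is the quadratic form of `(j† j)⁻¹` at `j†
w`. That inverse need not be bounded, so it is replaced by the resolvent `(j† j + δ)⁻¹`, for which
the chain rule follows from Fubini (`inner_primitive_primitive`). Letting `δ → 0` gives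
`norm_sq_eq_of_weak_evolution`. -/

namespace GRP

/-! ### Resolvents of positive operators. -/

section Resolvent

variable {E : Type*} [NormedAddCommGroup E] [InnerProductSpace ℝ E]

/-- The resolvent `(A + δ)⁻¹`, meaningful when `A` is positive and `δ > 0`. -/
noncomputable def posResolvent (A : E →L[ℝ] E) (δ : ℝ) : E →L[ℝ] E :=
  Ring.inverse (A + δ • (1 : E →L[ℝ] E))

variable {A : E →L[ℝ] E} {δ : ℝ}

theorem le_inner_add_smul_one (hA : A.IsPositive) (x : E) :
    δ * ‖x‖ ^ 2 ≤ inner ℝ ((A + δ • (1 : E →L[ℝ] E)) x) x := by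
  have h := hA.inner_nonneg_left x
  simp only [add_apply, smul_apply,
    one_apply_eq_self, inner_add_left, inner_smul_left,
    real_inner_self_eq_norm_sq, conj_trivial]
  linarith

variable [CompleteSpace E]

theorem isUnit_add_smul_one (hA : A.IsPositive) (hδ : 0 < δ) :
    IsUnit (A + δ • (1 : E →L[ℝ] E)) :=
  ContinuousLinearMap.isUnit_of_forall_le_norm_inner_map _ (c := ⟨δ, hδ.le⟩) hδ fun x =>
    calc ‖x‖ ^ 2 * δ = δ * ‖x‖ ^ 2 := mul_comm _ _
      _ ≤ _ := le_inner_add_smul_one hA x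
      _ ≤ _ := le_abs_self _

theorem add_smul_one_posResolvent (hA : A.IsPositive) (hδ : 0 < δ) (x : E) :
    A (posResolvent A δ x) + δ • posResolvent A δ x = x := by
  have := congrArg (fun B : E →L[ℝ] E => B x)
    (Ring.mul_inverse_cancel _ (isUnit_add_smul_one hA hδ))
  simpa [posResolvent] using this

theorem posResolvent_add_smul_one (hA : A.IsPositive) (hδ : 0 < δ) (x : E) :
    posResolvent A δ (A x + δ • x) = x := by
  have := congrArg (fun B : E →L[ℝ] E => B x)
    (Ring.inverse_mul_cancel _ (isUnit_add_smul_one hA hδ))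
  simpa [posResolvent] using this

/-- Coercivity gives `δ‖y‖² ≤ ⟨x, y⟩` for `y = (A + δ)⁻¹ x`. The bound is uniform in `δ`, which the
limit `δ → 0` needs. -/
theorem norm_smul_posResolvent_le (hA : A.IsPositive) (hδ : 0 < δ) (x : E) :
    ‖δ • posResolvent A δ x‖ ≤ ‖x‖ := by
  set y := posResolvent A δ x with hy
  have h1 := le_inner_add_smul_one (δ := δ) hA y
  have h2 : (A + δ • (1 : E →L[ℝ] E)) y = x := by
    simpa using add_smul_one_posResolvent hA hδ x
  rw [h2] at h1
  have h3 := h1.trans (real_inner_le_norm x y)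
  rw [norm_smul, Real.norm_of_nonneg hδ.le]
  rcases (norm_nonneg y).eq_or_lt with h | h
  · rw [← h]; simp
  · nlinarith

theorem inner_posResolvent_comm (hA : A.IsPositive) (hδ : 0 < δ) (x y : E) :
    inner ℝ (posResolvent A δ x) y = inner ℝ x (posResolvent A δ y) := by
  conv_lhs => rw [← add_smul_one_posResolvent hA hδ y]
  conv_rhs => rw [← add_smul_one_posResolvent hA hδ x]
  have h := hA.isSymmetric (posResolvent A δ x) (posResolvent A δ y)
  simp only [ContinuousLinearMap.coe_coe] at h
  simp only [inner_add_left, inner_add_right, inner_smul_left, inner_smul_right, conj_trivial, h]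

/-- The orthogonal complement of the range is the kernel of the adjoint, here `A` itself. -/
theorem denseRange_of_isPositive_of_injective (hA : A.IsPositive)
    (hinj : Function.Injective A) : DenseRange A := by
  have h := A.orthogonal_range
  rw [hA.isSelfAdjoint.adjoint_eq, LinearMap.ker_eq_bot.mpr hinj,
    ← Submodule.topologicalClosure_eq_top_iff] at h
  rw [DenseRange, dense_iff_closure_eq]
  have h' := congrArg (fun K : Submodule ℝ E => (K : Set E)) h
  rwa [Submodule.topologicalClosure_coe] at h'

/-- For `A` positive and injective, `δ (A + δ)⁻¹ → 0` strongly as `δ → 0`. -/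
theorem tendsto_smul_posResolvent (hA : A.IsPositive) (hinj : Function.Injective A) (x : E) :
    Tendsto (fun δ => δ • posResolvent A δ x) (𝓝[>] 0) (𝓝 0) := by
  rw [Metric.tendsto_nhds]
  intro ε hε
  obtain ⟨z, hz⟩ := (denseRange_of_isPositive_of_injective hA hinj).exists_dist_lt x
    (half_pos hε)
  have hlim : Tendsto (fun δ : ℝ => 2 * δ * ‖z‖) (𝓝[>] 0) (𝓝 0) := by
    have : Tendsto (fun δ : ℝ => 2 * δ * ‖z‖) (𝓝 0) (𝓝 (2 * 0 * ‖z‖)) :=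
      ((continuous_const.mul continuous_id).mul continuous_const).tendsto 0
    simp only [mul_zero, zero_mul] at this
    exact this.mono_left nhdsWithin_le_nhds
  filter_upwards [self_mem_nhdsWithin, hlim.eventually_lt_const (half_pos hε)] with δ hδ hsmall
  have hδ : 0 < δ := hδ
  -- On the range of `A` the quantity is of order `δ`; the contraction bound extends the limit to
  -- the closure of the range.
  have e1 : posResolvent A δ (A z) = z - δ • posResolvent A δ z := by
    have := posResolvent_add_smul_one hA hδ z
    rw [map_add, map_smul] at this
    exact eq_sub_of_add_eq this
  have e2 : ‖δ • posResolvent A δ (A z)‖ ≤ 2 * δ * ‖z‖ := by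
    rw [e1, norm_smul, Real.norm_of_nonneg hδ.le]
    have := (norm_sub_le z (δ • posResolvent A δ z)).trans
      (add_le_add_right (norm_smul_posResolvent_le hA hδ z) _)
    nlinarith
  have e3 := norm_smul_posResolvent_le hA hδ (x - A z)
  rw [dist_eq_norm] at hz
  rw [dist_zero_right]
  calc ‖δ • posResolvent A δ x‖
      = ‖δ • posResolvent A δ (x - A z) + δ • posResolvent A δ (A z)‖ := by
        rw [← smul_add, ← map_add, sub_add_cancel]
    _ ≤ _ := norm_add_le _ _
    _ < ε := by linarith

end Resolvent

/-! ### Chain rule for quadratic forms along primitives. -/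

section Primitive

variable {E : Type*} [NormedAddCommGroup E] [InnerProductSpace ℝ E] [CompleteSpace E]

/-- The chain rule `‖y‖² = 2 ∫ ⟨y, y'⟩` for the quadratic form of a symmetric operator along
the primitive of an integrable function. -/
theorem inner_primitive_primitive (Q : E →L[ℝ] E)
    (hQ : ∀ x y, inner ℝ (Q x) y = inner ℝ x (Q y)) {F : ℝ → E} {t : ℝ} (ht : 0 ≤ t)
    (hF : IntegrableOn F (Ioc 0 t)) :
    inner ℝ (Q (∫ s in (0 : ℝ)..t, F s)) (∫ s in (0 : ℝ)..t, F s) =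
      2 * ∫ s in (0 : ℝ)..t, inner ℝ (Q (∫ r in (0 : ℝ)..s, F r)) (F s) := by
  set μ := volume.restrict (Ioc (0 : ℝ) t) with hμ
  have hF' : Integrable F μ := hF
  set g : ℝ × ℝ → ℝ := fun z => inner ℝ (Q (F z.1)) (F z.2) with hg
  have hgint : Integrable g (μ.prod μ) := by
    refine Integrable.op_fst_snd (op := fun x y : E => inner ℝ (Q x) y) (by fun_prop)
      ⟨‖Q‖, fun x y => ?_⟩ hF' hF'
    exact (norm_inner_le_norm _ _).trans
      (mul_le_mul_of_nonneg_right (Q.le_opNorm x) (norm_nonneg _))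
  have hslice : ∀ s, Integrable (fun r => inner ℝ (Q (F r)) (F s)) μ := fun s =>
    (Q.integrable_comp hF').inner_const (F s)
  have hleft : ∀ (ν : Measure ℝ) (s : ℝ), Integrable F ν →
      ∫ r, inner ℝ (Q (F r)) (F s) ∂ν = inner ℝ (Q (∫ r, F r ∂ν)) (F s) := by
    intro ν s hν
    rw [← Q.integral_comp_comm hν, real_inner_comm, ← integral_inner (Q.integrable_comp hν)]
    simp only [real_inner_comm]
  -- The square is cut along its diagonal. Symmetry of `Q` equates the integrals over the two open
  -- triangles, and the diagonal is null in every slice.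
  set S : Set (ℝ × ℝ) := {z | z.1 ≤ z.2} with hS
  have hSm : MeasurableSet S := measurableSet_le measurable_fst measurable_snd
  set S' : Set (ℝ × ℝ) := {z | z.1 < z.2} with hS'
  have hSm' : MeasurableSet S' := measurableSet_lt measurable_fst measurable_snd
  have hle : ∫ z, S.indicator g z ∂(μ.prod μ)
      = ∫ s in (0 : ℝ)..t, inner ℝ (Q (∫ r in (0 : ℝ)..s, F r)) (F s) := by
    rw [integral_prod_symm _ (hgint.indicator hSm), intervalIntegral.integral_of_le ht]
    refine setIntegral_congr_fun measurableSet_Ioc fun s hs => ?_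
    have : (fun r => S.indicator g (r, s))
        = (Iic s).indicator fun r => inner ℝ (Q (F r)) (F s) := by
      ext r; simp [S, g, indicator]
    simp only [this]
    rw [integral_indicator measurableSet_Iic, hleft _ _ hF'.integrableOn, hμ,
      Measure.restrict_restrict measurableSet_Iic, intervalIntegral.integral_of_le hs.1.le]
    congr 4
    ext r; simp only [mem_inter_iff, mem_Iic, mem_Ioc]
    exact ⟨fun h => ⟨h.2.1, h.1⟩, fun h => ⟨h.2, h.1, h.2.trans hs.2⟩⟩
  have hlt : ∫ z, S'.indicator g z ∂(μ.prod μ) = ∫ z, S.indicator g z ∂(μ.prod μ) := by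
    rw [integral_prod_symm _ (hgint.indicator hSm), integral_prod_symm _ (hgint.indicator hSm')]
    refine integral_congr_ae (Eventually.of_forall fun s => ?_)
    have h1 : (fun r => S.indicator g (r, s))
        = (Iic s).indicator fun r => inner ℝ (Q (F r)) (F s) := by
      ext r; simp [S, g, indicator]
    have h2 : (fun r => S'.indicator g (r, s))
        = (Iio s).indicator fun r => inner ℝ (Q (F r)) (F s) := by
      ext r; simp [S', g, indicator]
    simp only [h1, h2]
    rw [integral_indicator measurableSet_Iic, integral_indicator measurableSet_Iio,
      integral_Iic_eq_integral_Iio]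
  have hcompl : ∫ z, Sᶜ.indicator g z ∂(μ.prod μ) = ∫ z, S'.indicator g z ∂(μ.prod μ) := by
    rw [← integral_prod_swap]
    refine integral_congr_ae (Eventually.of_forall fun z => ?_)
    have : g z.swap = g z := by
      simp only [g, Prod.fst_swap, Prod.snd_swap]
      rw [hQ, real_inner_comm]
    by_cases h : z.1 < z.2 <;> simp [S, S', indicator, this, h]
  have htot : ∫ z, g z ∂(μ.prod μ)
      = inner ℝ (Q (∫ s in (0 : ℝ)..t, F s)) (∫ s in (0 : ℝ)..t, F s) := by
    rw [integral_prod_symm _ hgint, intervalIntegral.integral_of_le ht]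
    simp only [g, hleft _ _ hF']
    exact integral_inner hF' _
  rw [← htot, ← hle, two_mul]
  nth_rewrite 2 [← hlt]
  rw [← hcompl, ← integral_add (hgint.indicator hSm) (hgint.indicator hSm.compl)]
  simp only [indicator_self_add_compl_apply]

end Primitive

end GRP

namespace GRP

/-! ### Energy identity in a Gelfand triple. -/

section Energy

variable {E H : Type*} [NormedAddCommGroup E] [InnerProductSpace ℝ E] [CompleteSpace E]
  [NormedAddCommGroup H] [InnerProductSpace ℝ H] [CompleteSpace H]

open ContinuousLinearMap in
/-- The energy identity of a weak evolution equation `(j† w)' = -F`, `w(0) = 0`, in a Gelfand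
triple given by a dense continuous embedding `j`. -/
theorem norm_sq_eq_of_weak_evolution (j : E →L[ℝ] H) (hinj : Function.Injective j)
    (hdense : DenseRange j) {T : ℝ} {v F : ℝ → E}
    (hv : MemLp v 2 (volume.restrict (Ioo 0 T))) (hF : MemLp F 2 (volume.restrict (Ioo 0 T)))
    {w : ℝ → H} (hwv : ∀ᵐ t ∂(volume.restrict (Ioo 0 T)), w t = j (v t))
    (hw : ∀ h : E, ∀ t ∈ Ioo 0 T, inner ℝ (w t) (j h) = - ∫ s in (0 : ℝ)..t, inner ℝ (F s) h)
    {t : ℝ} (ht : t ∈ Ioo 0 T) :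
    ‖w t‖ ^ 2 = -2 * ∫ s in (0 : ℝ)..t, inner ℝ (F s) (v s) := by
  set S : E →L[ℝ] E := adjoint j ∘L j with hS
  set M : H →L[ℝ] H := j ∘L adjoint j with hM
  have hSpos : S.IsPositive := isPositive_adjoint_comp_self j
  have hMpos : M.IsPositive := isPositive_self_comp_adjoint j
  have hSinj : Function.Injective S := by
    rw [injective_iff_map_eq_zero]
    intro x hx
    have : inner ℝ (S x) x = 0 := by rw [hx, inner_zero_left]
    rw [hS, comp_apply, adjoint_inner_left, inner_self_eq_zero] at this
    exact (injective_iff_map_eq_zero j).mp hinj x this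
  have hMinj : Function.Injective M := by
    rw [injective_iff_map_eq_zero]
    intro x hx
    have : inner ℝ (M x) x = 0 := by rw [hx, inner_zero_left]
    rw [hM, comp_apply, ← adjoint_inner_right, inner_self_eq_zero] at this
    refine hdense.eq_zero_of_inner_left ℝ fun y => ?_
    rw [← adjoint_inner_left, this, inner_zero_left]
  have hFint : IntegrableOn F (Ioo 0 T) := hF.integrable (by norm_num)
  have hFt : ∀ s ∈ Ioo 0 T, IntegrableOn F (Ioc 0 s) := fun s hs =>
    hFint.mono_set fun r hr => ⟨hr.1, hr.2.trans_lt hs.2⟩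
  have hsub : Ioc 0 t ⊆ Ioo 0 T := fun r hr => ⟨hr.1, hr.2.trans_lt ht.2⟩
  have hprim : ∀ s ∈ Ioo 0 T, adjoint j (w s) = - ∫ r in (0 : ℝ)..s, F r := by
    intro s hs
    refine ext_inner_right ℝ fun h => ?_
    rw [adjoint_inner_left, hw h s hs, inner_neg_left, intervalIntegral.integral_of_le hs.1.le,
      intervalIntegral.integral_of_le hs.1.le, real_inner_comm, ← integral_inner (hFt s hs)]
    simp only [real_inner_comm]
  have hid : ∀ δ > 0, inner ℝ (w t - δ • posResolvent M δ (w t)) (w t)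
      = -2 * ∫ s in (0 : ℝ)..t, inner ℝ (F s) (v s - δ • posResolvent S δ (v s)) := by
    intro δ hδ
    have h1 := inner_primitive_primitive (posResolvent S δ) (inner_posResolvent_comm hSpos hδ)
      ht.1.le (hFt t ht)
    -- Since `M j = j S`, the resolvents of `M` and `S` are intertwined by `j`.
    have hint : ∀ x, posResolvent M δ (j x) = j (posResolvent S δ x) := by
      intro x
      conv_lhs => rw [← add_smul_one_posResolvent hSpos hδ x]
      rw [map_add, map_smul]
      exact posResolvent_add_smul_one hMpos hδ _
    have hRS : ∀ x, posResolvent S δ (S x) = x - δ • posResolvent S δ x := by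
      intro x
      have := posResolvent_add_smul_one hSpos hδ x
      rw [map_add, map_smul] at this
      exact eq_sub_of_add_eq this
    have hNM : posResolvent M δ (M (w t)) = w t - δ • posResolvent M δ (w t) := by
      have := posResolvent_add_smul_one hMpos hδ (w t)
      rw [map_add, map_smul] at this
      exact eq_sub_of_add_eq this
    rw [← neg_neg (∫ s in (0 : ℝ)..t, F s), ← hprim t ht, map_neg, inner_neg_neg,
      ← adjoint_inner_left, adjoint_adjoint, ← hint] at h1
    rw [← hNM, hM, comp_apply, h1, neg_mul, ← mul_neg, ← intervalIntegral.integral_neg]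
    congr 1
    rw [intervalIntegral.integral_of_le ht.1.le, intervalIntegral.integral_of_le ht.1.le]
    refine setIntegral_congr_ae measurableSet_Ioc ?_
    filter_upwards [(ae_restrict_iff' measurableSet_Ioo).mp hwv] with s hs hst
    have hsT := hsub hst
    -- For almost every `s` the primitive of `F` is `-j† (w s) = -S (v s)`.
    rw [← neg_neg (∫ r in (0 : ℝ)..s, F r), ← hprim s hsT, hs hsT, map_neg, inner_neg_left]
    change -inner ℝ (posResolvent S δ (S (v s))) (F s) = _
    rw [hRS, real_inner_comm]
  have hlim1 : Tendsto (fun δ => inner ℝ (w t - δ • posResolvent M δ (w t)) (w t)) (𝓝[>] 0)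
      (𝓝 (‖w t‖ ^ 2)) := by
    have := (tendsto_const_nhds (x := w t)).sub (tendsto_smul_posResolvent hMpos hMinj (w t))
    rw [sub_zero] at this
    have h2 := this.inner (𝕜 := ℝ) (tendsto_const_nhds (x := w t))
    rwa [real_inner_self_eq_norm_sq] at h2
  have hlim2 : Tendsto (fun δ => ∫ s in (0 : ℝ)..t, inner ℝ (F s)
      (v s - δ • posResolvent S δ (v s))) (𝓝[>] 0)
      (𝓝 (∫ s in (0 : ℝ)..t, inner ℝ (F s) (v s))) := by
    have hres : volume.restrict (uIoc 0 t) ≤ volume.restrict (Ioo 0 T) := by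
      rw [uIoc_of_le ht.1.le]; exact Measure.restrict_mono hsub le_rfl
    -- The contraction bound on `δ (S + δ)⁻¹` gives the factor 2 in the dominating function.
    refine intervalIntegral.tendsto_integral_filter_of_dominated_convergence
      (fun s => ‖F s‖ * (2 * ‖v s‖)) ?_ ?_ ?_ ?_
    · refine Eventually.of_forall fun δ => ?_
      have h1 := (hv.1.mono_measure hres)
      exact (hF.1.mono_measure hres).inner (h1.sub
        (((posResolvent S δ).continuous.comp_aestronglyMeasurable h1).const_smul δ))
    · filter_upwards [self_mem_nhdsWithin] with δ hδ
      refine Eventually.of_forall fun s _ => (norm_inner_le_norm _ _).trans ?_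
      refine mul_le_mul_of_nonneg_left ?_ (norm_nonneg _)
      have := norm_smul_posResolvent_le hSpos hδ (v s)
      linarith [norm_sub_le (v s) (δ • posResolvent S δ (v s))]
    · rw [intervalIntegrable_iff]
      exact (hF.norm.integrable_mul (hv.norm.const_mul 2)).mono_measure hres
    · refine Eventually.of_forall fun s _ => ?_
      have := (tendsto_const_nhds (x := v s)).sub (tendsto_smul_posResolvent hSpos hSinj (v s))
      rw [sub_zero] at this
      exact (tendsto_const_nhds (x := F s)).inner (𝕜 := ℝ) this
  refine tendsto_nhds_unique hlim1 ((hlim2.const_mul (-2)).congr' ?_)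
  filter_upwards [self_mem_nhdsWithin] with δ hδ
  exact (hid δ hδ).symm

end Energy

/-! ### Integral form of Gronwall's inequality. -/

section Gronwall

/-- Gronwall's inequality for an absolutely continuous function with a dissipation term. -/
theorem primitive_add_integral_le_of_gronwall {T C D : ℝ} (hT : 0 ≤ T) (hC : 0 < C)
    {f a b : ℝ → ℝ} (hf : IntegrableOn f (Icc 0 T)) (ha : IntegrableOn a (Icc 0 T))
    (hb : IntegrableOn b (Icc 0 T)) (ha0 : ∀ s, 0 ≤ a s) (hb0 : ∀ s, 0 ≤ b s)
    (hD : ∫ s in (0 : ℝ)..T, b s ≤ D)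
    (hfab : ∀ᵐ s ∂(volume.restrict (Icc 0 T)),
      f s ≤ - a s + C * (∫ r in (0 : ℝ)..s, f r) + b s)
    {t : ℝ} (ht : t ∈ Icc 0 T) :
    (∫ s in (0 : ℝ)..t, f s) + ∫ s in (0 : ℝ)..t, a s ≤ D * Real.exp (C * T) := by
  have hint : ∀ {g : ℝ → ℝ}, IntegrableOn g (Icc 0 T) → ∀ t ∈ Icc 0 T,
      IntervalIntegrable g volume 0 t := by
    intro g hg t ht
    rw [intervalIntegrable_iff_integrableOn_Icc_of_le ht.1]
    exact hg.mono_set (Icc_subset_Icc_right ht.2)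
  set z : ℝ → ℝ := fun t => ∫ s in (0 : ℝ)..t, f s with hz
  have hzc : ContinuousOn z (Icc 0 T) := by
    rw [← uIcc_of_le hT] at hf ⊢
    exact intervalIntegral.continuousOn_primitive_interval hf
  have hzi : IntegrableOn z (Icc 0 T) := hzc.integrableOn_compact isCompact_Icc
  have hYc : ContinuousOn (fun t => ∫ s in (0 : ℝ)..t, z s) (Icc 0 T) := by
    rw [← uIcc_of_le hT] at hzi ⊢
    exact intervalIntegral.continuousOn_primitive_interval hzi
  have hDt : ∀ t ∈ Icc 0 T, ∫ s in (0 : ℝ)..t, b s ≤ D := fun t ht =>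
    (intervalIntegral.integral_mono_interval le_rfl ht.1 ht.2 (Eventually.of_forall hb0)
      (hint hb T ⟨hT, le_rfl⟩)).trans hD
  have key : ∀ t ∈ Icc 0 T, z t + ∫ s in (0 : ℝ)..t, a s
      ≤ C * (∫ s in (0 : ℝ)..t, z s) + D := by
    intro t ht
    have hna : IntervalIntegrable (fun s => - a s) volume 0 t := (hint ha t ht).neg
    have h1 : z t ≤ ∫ s in (0 : ℝ)..t, (- a s + C * z s + b s) := by
      refine intervalIntegral.integral_mono_ae_restrict ht.1 (hint hf t ht)
        ((hna.add ((hint hzi t ht).const_mul C)).add (hint hb t ht)) ?_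
      exact ae_restrict_of_ae_restrict_of_subset (Icc_subset_Icc_right ht.2) hfab
    rw [intervalIntegral.integral_add (hna.add ((hint hzi t ht).const_mul C))
      (hint hb t ht), intervalIntegral.integral_add hna
      ((hint hzi t ht).const_mul C), intervalIntegral.integral_neg,
      intervalIntegral.integral_const_mul] at h1
    linarith [hDt t ht]
  -- Gronwall is applied to the primitive `Y` of `z`: as `z` is continuous, `Y` has a right
  -- derivative everywhere on `[0, T)`, and `Y' ≤ C Y + D` by `key`.
  have hY := le_gronwallBound_of_liminf_deriv_right_le (f := fun t => ∫ s in (0 : ℝ)..t, z s)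
    (f' := z) (δ := 0) (K := C) (ε := D) hYc
    (fun x hx r hr => by
      have hd : HasDerivWithinAt (fun t => ∫ s in (0 : ℝ)..t, z s) (z x) (Ici x) x := by
        refine intervalIntegral.integral_hasDerivWithinAt_right (t := Ioi x)
          (hint hzi x ⟨hx.1, hx.2.le⟩) ?_ ?_
        · exact ⟨Icc 0 T, mem_of_superset (Ioc_mem_nhdsGT hx.2) fun y hy =>
            ⟨hx.1.trans hy.1.le, hy.2⟩, hzi.1⟩
        · refine (hzc x ⟨hx.1, hx.2.le⟩).mono_of_mem_nhdsWithin ?_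
          exact mem_of_superset (Ioc_mem_nhdsGT hx.2) fun y hy => ⟨hx.1.trans hy.1.le, hy.2⟩
      exact hd.liminf_right_slope_le hr)
    (by simp) (fun x hx => by
      have := key x ⟨hx.1, hx.2.le⟩
      have h0 : 0 ≤ ∫ s in (0 : ℝ)..x, a s :=
        intervalIntegral.integral_nonneg hx.1 fun s _ => ha0 s
      linarith) t ht
  rw [gronwallBound_of_K_ne_0 hC.ne', sub_zero] at hY
  have hY' : C * (∫ s in (0 : ℝ)..t, z s) ≤ D * (Real.exp (C * t) - 1) := by
    have := mul_le_mul_of_nonneg_left hY hC.le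
    have e : C * (0 * Real.exp (C * t) + D / C * (Real.exp (C * t) - 1))
        = D * (Real.exp (C * t) - 1) := by field_simp; ring
    exact this.trans_eq e
  have hD0 : 0 ≤ D := (intervalIntegral.integral_nonneg hT fun s _ => hb0 s).trans hD
  calc _ ≤ C * (∫ s in (0 : ℝ)..t, z s) + D := key t ht
    _ ≤ D * Real.exp (C * t) := by linarith
    _ ≤ D * Real.exp (C * T) := by gcongr; exact ht.2

end Gronwall

end GRP

namespace GRP

/-! ### The embedding of `H10` and multiplication by bounded functions. -/

section Spaces

/-- The embedding `H¹₀(G) → L₂(G)`. -/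
noncomputable def H10.toL2L : H10 →L[ℝ] L2G :=
  WithLp.fstL 2 ℝ L2G L2G ∘L testGraph.topologicalClosure.subtypeL

/-- The generalized derivative `H¹₀(G) → L₂(G)`. -/
noncomputable def H10.derivativeL : H10 →L[ℝ] L2G :=
  WithLp.sndL 2 ℝ L2G L2G ∘L testGraph.topologicalClosure.subtypeL

@[simp] theorem H10.toL2L_apply (h : H10) : H10.toL2L h = h.toL2 := rfl

@[simp] theorem H10.derivativeL_apply (h : H10) : H10.derivativeL h = h.derivative := rfl

theorem L2G.integral_mul_eq_inner (g k : L2G) : ∫ x in G, g x * k x = inner ℝ g k := by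
  rw [L2.inner_def]
  refine integral_congr_ae (Eventually.of_forall fun x => ?_)
  simp [mul_comm]

theorem IsTestFunction.memLp {f : ℝ → ℝ} (hf : IsTestFunction f) :
    MemLp f 2 (volume.restrict G) :=
  (hf.1.continuous.memLp_of_hasCompactSupport hf.2.1).restrict G

theorem IsTestFunction.memLp_deriv {f : ℝ → ℝ} (hf : IsTestFunction f) :
    MemLp (deriv f) 2 (volume.restrict G) :=
  ((hf.1.continuous_deriv (by simp)).memLp_of_hasCompactSupport hf.2.1.deriv).restrict G

/-- The fundamental lemma of the calculus of variations in `L₂(G)`. -/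
theorem L2G.eq_zero_of_forall_integral_test {g : L2G}
    (h : ∀ f, IsTestFunction f → ∫ x in G, g x * f x = 0) : g = 0 := by
  have hint : IntegrableOn g G := (Lp.memLp g).integrable (by norm_num)
  have h0 := isOpen_Ioo.ae_eq_zero_of_integral_contDiff_smul_eq_zero
    (U := G) hint.locallyIntegrableOn fun f hf hfc hfG => by
      rw [← h f ⟨hf, hfc, hfG⟩]
      rw [← setIntegral_eq_integral_of_forall_compl_eq_zero (s := G)]
      · simp only [smul_eq_mul, mul_comm]
      · intro x hx
        rw [image_eq_zero_of_notMem_tsupport (fun h => hx (hfG h)), zero_smul]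
  rw [Lp.eq_zero_iff_ae_eq_zero]
  exact (ae_restrict_iff' measurableSet_Ioo).mpr h0

/-- This is closability of the derivative: integration by parts against test functions rules out
pairs `(0, k)` with `k ≠ 0` in the closure. -/
theorem H10.toL2L_injective : Function.Injective H10.toL2L := by
  rw [injective_iff_map_eq_zero]
  intro h hh
  rw [H10.toL2L_apply] at hh
  have hd : h.derivative = 0 := L2G.eq_zero_of_forall_integral_test fun f hf => by
    rw [h.integral_derivative f hf, neg_eq_zero, hh]
    refine integral_eq_zero_of_ae ?_
    filter_upwards [Lp.coeFn_zero ℝ 2 (volume.restrict G)] with x hx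
    rw [hx]; simp
  have := h.norm_sq
  rw [hh, hd] at this
  simpa using this

/-- A test function as an element of `H¹₀(G)`. -/
noncomputable def IsTestFunction.toH10 {f : ℝ → ℝ} (hf : IsTestFunction f) : H10 :=
  ⟨WithLp.toLp 2 (hf.memLp.toLp f, hf.memLp_deriv.toLp (deriv f)),
    testGraph.le_topologicalClosure ⟨f, hf, hf.memLp.coeFn_toLp, hf.memLp_deriv.coeFn_toLp⟩⟩

/-- The range contains all test functions, and only zero is orthogonal to these. -/
theorem H10.denseRange_toL2L : DenseRange H10.toL2L := by
  have h : (LinearMap.range (H10.toL2L : H10 →ₗ[ℝ] L2G))ᗮ = ⊥ := by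
    rw [Submodule.eq_bot_iff]
    intro g hg
    refine L2G.eq_zero_of_forall_integral_test fun f hf => ?_
    have h0 : inner ℝ (hf.toH10.toL2) g = 0 := hg _ ⟨hf.toH10, rfl⟩
    rw [real_inner_comm, ← L2G.integral_mul_eq_inner] at h0
    rw [← h0]
    refine integral_congr_ae ?_
    filter_upwards [hf.memLp.coeFn_toLp] with x hx
    change _ = g x * (hf.memLp.toLp f) x
    rw [hx]
  rw [← Submodule.topologicalClosure_eq_top_iff] at h
  have h' := congrArg (fun K : Submodule ℝ L2G => (K : Set L2G)) h
  rw [DenseRange, dense_iff_closure_eq]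
  rwa [Submodule.topologicalClosure_coe] at h'

/-- Multiplication `L_∞(G) × L₂(G) → L₂(G)`. -/
noncomputable def mulL : LInfG →L[ℝ] L2G →L[ℝ] L2G :=
  (ContinuousLinearMap.mul ℝ ℝ).holderL (volume.restrict G) ∞ 2 2

theorem coeFn_mulL (W : LInfG) (g : L2G) :
    mulL W g =ᵐ[volume.restrict G] fun x => W x * g x :=
  (ContinuousLinearMap.mul ℝ ℝ).coeFn_holder W g

theorem abs_inner_mulL_le (W : LInfG) (g k : L2G) :
    |inner ℝ (mulL W g) k| ≤ ‖W‖ * ‖g‖ * ‖k‖ := by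
  refine (abs_real_inner_le_norm _ _).trans (mul_le_mul_of_nonneg_right ?_ (norm_nonneg _))
  have := (ContinuousLinearMap.mul ℝ ℝ).norm_holder_apply_apply_le (r := 2) W g
  rw [ContinuousLinearMap.opNorm_mul, one_mul] at this
  exact this

end Spaces

/-! ### The bilinear form and stability in the coefficient. -/

section Form

open ContinuousLinearMap

/-- The operator on `H¹₀(G)` representing the bilinear form
`(v_x + v W, h_x)₀ + (v_x W, h)₀`. -/
noncomputable def formOperator (W : LInfG) : H10 →L[ℝ] H10 :=
  adjoint H10.derivativeL ∘L (H10.derivativeL + mulL W ∘L H10.toL2L) +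
    adjoint H10.toL2L ∘L (mulL W ∘L H10.derivativeL)

theorem inner_formOperator (W : LInfG) (v h : H10) :
    inner ℝ (formOperator W v) h = inner ℝ (v.derivative + mulL W v.toL2) h.derivative
      + inner ℝ (mulL W v.derivative) h.toL2 := by
  simp [formOperator, inner_add_left, adjoint_inner_left]

theorem integral_flux_mul_eq (W : LInfG) (v h : H10) :
    ∫ x in G, (v.derivative x + v.toL2 x * W x) * h.derivative x
      = inner ℝ (v.derivative + mulL W v.toL2) h.derivative := by
  rw [← L2G.integral_mul_eq_inner]
  refine integral_congr_ae ?_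
  filter_upwards [Lp.coeFn_add v.derivative (mulL W v.toL2), coeFn_mulL W v.toL2] with x h1 h2
  rw [h1, Pi.add_apply, h2, mul_comm (v.toL2 x)]

theorem integral_reaction_mul_eq (W : LInfG) (v h : H10) :
    ∫ x in G, v.derivative x * W x * h.toL2 x = inner ℝ (mulL W v.derivative) h.toL2 := by
  rw [← L2G.integral_mul_eq_inner]
  refine integral_congr_ae ?_
  filter_upwards [coeFn_mulL W v.derivative] with x h2
  rw [h2, mul_comm (W x)]

/-- Coercivity of the form, and its continuity in the coefficient. -/
theorem neg_two_inner_formOperator_sub_le {W W' : LInfG} {K : ℝ} (hK : ‖W'‖ ≤ K) (u u' : H10) :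
    -2 * inner ℝ (formOperator W u - formOperator W' u') (u - u')
      ≤ - ‖u - u'‖ ^ 2 + (8 * K ^ 2 + 2) * ‖(u - u').toL2‖ ^ 2
        + 2 * ‖W - W'‖ ^ 2 * ‖u‖ ^ 2 := by
  -- With this splitting the perturbation acts on `u` alone, so no bound on `u'` is needed.
  have e : formOperator W u - formOperator W' u'
      = formOperator W' (u - u') + (formOperator W u - formOperator W' u) := by
    rw [map_sub]; abel
  set v := u - u'
  have e2 : inner ℝ (formOperator W u - formOperator W' u) v
      = inner ℝ (mulL (W - W') u.toL2) v.derivative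
        + inner ℝ (mulL (W - W') u.derivative) v.toL2 := by
    simp only [inner_sub_left, inner_formOperator, map_sub, inner_add_left, sub_apply]
    ring
  rw [e, inner_add_left, e2, inner_formOperator, inner_add_left, real_inner_self_eq_norm_sq,
    v.norm_sq, u.norm_sq]
  have b1 := abs_le.mp (abs_inner_mulL_le W' v.toL2 v.derivative)
  have b2 := abs_le.mp (abs_inner_mulL_le W' v.derivative v.toL2)
  have b3 := abs_le.mp (abs_inner_mulL_le (W - W') u.toL2 v.derivative)
  have b4 := abs_le.mp (abs_inner_mulL_le (W - W') u.derivative v.toL2)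
  set p := ‖v.toL2‖
  set q := ‖v.derivative‖
  set a := ‖u.toL2‖
  set b := ‖u.derivative‖
  set δ := ‖W - W'‖
  have hpq : ‖W'‖ * (p * q) ≤ K * (p * q) :=
    mul_le_mul_of_nonneg_right hK (by positivity)
  -- Young's inequality: `4Kpq ≤ q²/2 + 8K²p²`, `2δaq ≤ q²/2 + 2δ²a²` and `2δbp ≤ p² + δ²b²`. One
  -- more `p²` completes `q²` to the full norm, hence `8K² + 2`.
  nlinarith [sq_nonneg (q - 4 * K * p), sq_nonneg (q - 2 * δ * a), sq_nonneg (δ * b - p),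
    sq_nonneg (δ * b)]

variable {T : ℝ} {W W' : LInfG} {φ : L2G} {u u' : L2H10 T} {ut ut' : ℝ → L2G}

theorem memLp_formOperator_comp (W : LInfG) (u : L2H10 T) :
    MemLp (fun s => formOperator W (u s)) 2 (volume.restrict (Ioo 0 T)) :=
  (formOperator W).comp_memLp' (Lp.memLp u)

/-- A map integrable on `(0,T)` is interval integrable on `0..t`. -/
theorem intervalIntegrable_of_mem_Ioo {E : Type*} [NormedAddCommGroup E] {f : ℝ → E}
    (hf : IntegrableOn f (Ioo 0 T)) {t : ℝ} (ht : t ∈ Ioo 0 T) :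
    IntervalIntegrable f volume 0 t := by
  rw [intervalIntegrable_iff_integrableOn_Ioc_of_le ht.1.le]
  exact hf.mono_set fun r hr => ⟨hr.1, hr.2.trans_lt ht.2⟩

theorem integrableOn_clm_comp {E : Type*} [NormedAddCommGroup E] [NormedSpace ℝ E]
    (A : H10 →L[ℝ] E) (u : L2H10 T) : IntegrableOn (fun s => A (u s)) (Ioo 0 T) :=
  A.integrable_comp ((Lp.memLp u).integrable (by norm_num))

/-- Merges the two time integrals into the single weak form required by
`norm_sq_eq_of_weak_evolution`. -/
theorem IsGeneralizedSolution.inner_eq (hu : IsGeneralizedSolution T W φ u ut) (h : H10)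
    {t : ℝ} (ht : t ∈ Ioo 0 T) :
    inner ℝ (ut t) h.toL2
      = inner ℝ φ h.toL2 - ∫ s in (0 : ℝ)..t, inner ℝ (formOperator W (u s)) h := by
  have := hu.identity h t ht
  rw [L2G.integral_mul_eq_inner, L2G.integral_mul_eq_inner, sub_sub] at this
  rw [this]
  simp only [integral_flux_mul_eq, integral_reaction_mul_eq, inner_formOperator]
  congr 1
  rw [intervalIntegral.integral_add]
  · refine intervalIntegrable_of_mem_Ioo ?_ ht
    exact (integrableOn_clm_comp (H10.derivativeL + mulL W ∘L H10.toL2L) u).inner_const _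
  · refine intervalIntegrable_of_mem_Ioo ?_ ht
    exact (integrableOn_clm_comp (mulL W ∘L H10.derivativeL) u).inner_const _

/-- The energy identity for the difference of two solutions. -/
theorem IsGeneralizedSolution.norm_sub_sq_eq (hu : IsGeneralizedSolution T W φ u ut)
    (hu' : IsGeneralizedSolution T W' φ u' ut') {t : ℝ} (ht : t ∈ Ioo 0 T) :
    ‖ut t - ut' t‖ ^ 2 = ∫ s in (0 : ℝ)..t,
      -2 * inner ℝ (formOperator W (u s) - formOperator W' (u' s)) (u s - u' s) := by
  rw [intervalIntegral.integral_const_mul]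
  refine norm_sq_eq_of_weak_evolution H10.toL2L H10.toL2L_injective H10.denseRange_toL2L
    (v := fun s => u s - u' s) (F := fun s => formOperator W (u s) - formOperator W' (u' s))
    (w := fun s => ut s - ut' s)
    ((Lp.memLp u).sub (Lp.memLp u'))
    ((memLp_formOperator_comp W u).sub (memLp_formOperator_comp W' u')) ?_ ?_ ht
  · filter_upwards [hu.version, hu'.version] with s h1 h2
    rw [h1, h2, map_sub, H10.toL2L_apply, H10.toL2L_apply]
  · intro h s hs
    -- The common initial datum `φ` cancels.
    rw [inner_sub_left, H10.toL2L_apply, hu.inner_eq h hs, hu'.inner_eq h hs]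
    simp only [inner_sub_left]
    rw [intervalIntegral.integral_sub]
    · ring
    · refine intervalIntegrable_of_mem_Ioo ?_ hs
      exact (integrableOn_clm_comp (formOperator W) u).inner_const h
    · refine intervalIntegrable_of_mem_Ioo ?_ hs
      exact (integrableOn_clm_comp (formOperator W') u').inner_const h

/-- Gronwall applied to the energy identity. The constant depends on `W'` only through `K`, so it
can be kept uniform along a convergent family. -/
theorem IsGeneralizedSolution.stability (hT : 0 < T) (hu : IsGeneralizedSolution T W φ u ut)
    (hu' : IsGeneralizedSolution T W' φ u' ut') {K : ℝ} (hK : ‖W'‖ ≤ K) :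
    (⨆ t ∈ Ioo (0 : ℝ) T, ‖ut t - ut' t‖ₑ ^ 2) + ∫⁻ s in Ioo (0 : ℝ) T, ‖u s - u' s‖ₑ ^ 2
      ≤ 2 * ENNReal.ofReal (2 * ‖W - W'‖ ^ 2 * (∫ s in (0 : ℝ)..T, ‖u s‖ ^ 2)
          * Real.exp ((8 * K ^ 2 + 2) * T)) := by
  set v : ℝ → H10 := fun s => u s - u' s with hv
  set f : ℝ → ℝ := fun s =>
    -2 * inner ℝ (formOperator W (u s) - formOperator W' (u' s)) (v s) with hf
  set B := 2 * ‖W - W'‖ ^ 2 * (∫ s in (0 : ℝ)..T, ‖u s‖ ^ 2)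
    * Real.exp ((8 * K ^ 2 + 2) * T) with hB
  have hvL : MemLp v 2 (volume.restrict (Ioo 0 T)) := (Lp.memLp u).sub (Lp.memLp u')
  have hsqv : IntegrableOn (fun s => ‖v s‖ ^ 2) (Ioo 0 T) := hvL.norm.integrable_sq
  have hfi : IntegrableOn f (Icc 0 T) := by
    rw [integrableOn_Icc_iff_integrableOn_Ioo]
    have hA := (memLp_formOperator_comp W u).sub (memLp_formOperator_comp W' u')
    exact ((hA.norm.integrable_mul hvL.norm).mono' (hA.1.inner hvL.1)
      (Eventually.of_forall fun s => norm_inner_le_norm _ _)).const_mul (-2)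
  have henergy : ∀ t ∈ Ioo 0 T, ‖ut t - ut' t‖ ^ 2 = ∫ s in (0 : ℝ)..t, f s := fun t ht =>
    hu.norm_sub_sq_eq hu' ht
  have hmain : ∀ t ∈ Icc 0 T, (∫ s in (0 : ℝ)..t, f s) + ∫ s in (0 : ℝ)..t, ‖v s‖ ^ 2 ≤ B := by
    intro t ht
    refine primitive_add_integral_le_of_gronwall (b := fun s => 2 * ‖W - W'‖ ^ 2 * ‖u s‖ ^ 2)
      hT.le (by positivity) hfi ?_ ?_
      (fun s => by positivity) (fun s => by positivity) ?_ ?_ ht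
    · rwa [integrableOn_Icc_iff_integrableOn_Ioo]
    · rw [integrableOn_Icc_iff_integrableOn_Ioo]
      exact (Lp.memLp u).norm.integrable_sq.const_mul _
    · rw [intervalIntegral.integral_const_mul]
    · rw [← Measure.restrict_congr_set Ioo_ae_eq_Icc]
      filter_upwards [hu.version, hu'.version, ae_restrict_mem measurableSet_Ioo]
        with s h1 h2 hs
      -- The energy identity turns the primitive of `f` into `‖(u s - u' s).toL2‖ ^ 2`, as in the
      -- coercivity estimate.
      rw [← henergy s hs, h1, h2]
      exact neg_two_inner_formOperator_sub_le hK (u s) (u' s)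
  -- The energy identity holds only for `t < T`; the sign at `T` follows by continuity.
  have hfT : 0 ≤ ∫ s in (0 : ℝ)..T, f s := by
    have hc : ContinuousOn (fun t => ∫ s in (0 : ℝ)..t, f s) (Icc 0 T) := by
      rw [← uIcc_of_le hT.le] at hfi ⊢
      exact intervalIntegral.continuousOn_primitive_interval hfi
    have ht := (hc T ⟨hT.le, le_rfl⟩).mono Ioo_subset_Icc_self
    have : (𝓝[Ioo 0 T] T).NeBot := by
      rw [nhdsWithin_Ioo_eq_nhdsLT hT]; infer_instance
    refine ge_of_tendsto ht.tendsto ?_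
    filter_upwards [self_mem_nhdsWithin] with t ht
    rw [← henergy t ht]; positivity
  have enorm_sq : ∀ {E : Type} [NormedAddCommGroup E] (x : E),
      ‖x‖ₑ ^ 2 = ENNReal.ofReal (‖x‖ ^ 2) := by
    intro E _ x
    rw [← ofReal_norm, ENNReal.ofReal_pow (norm_nonneg _)]
  rw [two_mul]
  -- Both terms in `hmain` are nonnegative, so each is at most `B`; hence the factor 2.
  refine add_le_add (iSup₂_le fun t ht => ?_) ?_
  · rw [enorm_sq]
    refine ENNReal.ofReal_le_ofReal ?_
    rw [henergy t ht]
    have h0 : 0 ≤ ∫ s in (0 : ℝ)..t, ‖v s‖ ^ 2 :=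
      intervalIntegral.integral_nonneg ht.1.le fun s _ => by positivity
    linarith [hmain t (Ioo_subset_Icc_self ht)]
  · simp only [enorm_sq]
    rw [← ofReal_integral_eq_lintegral_ofReal hsqv (Eventually.of_forall fun s => by positivity)]
    refine ENNReal.ofReal_le_ofReal ?_
    have := hmain T ⟨hT.le, le_rfl⟩
    rw [intervalIntegral.integral_of_le (f := fun s => ‖v s‖ ^ 2) hT.le,
      integral_Ioc_eq_integral_Ioo] at this
    linarith

end Form

end GRP

theorem theorem3p2 (T : ℝ) (hT : 0 < T)
    (W : GRP.LInfG) (Weps : ℝ → GRP.LInfG) (φ : GRP.L2G)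
    (u : GRP.L2H10 T) (ut : ℝ → GRP.L2G)
    (hu : GRP.IsGeneralizedSolution T W φ u ut)
    (ueps : ℝ → GRP.L2H10 T) (uteps : ℝ → ℝ → GRP.L2G)
    (hueps : ∀ ε : ℝ, 0 < ε →
      GRP.IsGeneralizedSolution T (Weps ε) φ (ueps ε) (uteps ε))
    (hW : Tendsto (fun ε : ℝ => ‖W - Weps ε‖) (𝓝[>] 0) (𝓝 0)) :
    Tendsto (fun ε : ℝ =>
        (⨆ t ∈ Ioo (0 : ℝ) T, ‖ut t - uteps ε t‖ₑ ^ 2)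
          + ∫⁻ s in Ioo (0 : ℝ) T, ‖u s - ueps ε s‖ₑ ^ 2)
      (𝓝[>] 0) (𝓝 0) := by
  have hlim : Tendsto (fun ε : ℝ => 2 * ENNReal.ofReal (2 * ‖W - Weps ε‖ ^ 2
      * (∫ s in (0 : ℝ)..T, ‖u s‖ ^ 2) * Real.exp ((8 * (‖W‖ + 1) ^ 2 + 2) * T)))
      (𝓝[>] 0) (𝓝 0) := by
    have h1 : Tendsto (fun ε : ℝ => 2 * ‖W - Weps ε‖ ^ 2
        * (∫ s in (0 : ℝ)..T, ‖u s‖ ^ 2) * Real.exp ((8 * (‖W‖ + 1) ^ 2 + 2) * T))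
        (𝓝[>] 0) (𝓝 0) := by
      simpa using (((hW.pow 2).const_mul 2).mul_const (∫ s in (0 : ℝ)..T, ‖u s‖ ^ 2)).mul_const
        (Real.exp ((8 * (‖W‖ + 1) ^ 2 + 2) * T))
    have h2 := ENNReal.Tendsto.const_mul (a := 2) (ENNReal.tendsto_ofReal h1) (by simp)
    simpa using h2
  refine tendsto_of_tendsto_of_tendsto_of_le_of_le' tendsto_const_nhds hlim
    (Eventually.of_forall fun _ => bot_le) ?_
  -- Once `‖W - Weps ε‖ < 1`, the uniform bound `K = ‖W‖ + 1` applies.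
  filter_upwards [self_mem_nhdsWithin, hW.eventually_lt_const one_pos] with ε hε hsmall
  refine hu.stability hT (hueps ε hε) ?_
  have := norm_sub_norm_le (Weps ε) W
  rw [norm_sub_rev] at this
  linarith
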